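/- Theorem. Consider a linear time-invariant port-Hamiltonian (PH) system with $n$ states, $m$ inputs and $m$ outputs, $$E\dot x(t)=(J-R)Q\,x(t)+(F-P)\,u(t),\qquad y(t)=(F+P)^TQ\,x(t)+(S+N)\,u(t),$$ where $E,J,R,Q\in\mathbb R^{n,n}$, $F,P\in\mathbb R^{n,m}$, $S,N\in\mathbb R^{m,m}$ satisfy: $Q$ is invertible, $Q^TE=E^TQ\succeq 0$, $J^T=-J$, $R\succeq 0$, $S\succeq 0$, $N^T=-N$, and the cost matrix $$K=\begin{bmatrix}R&P\\P^T&S\end{bmatrix}$$ is positive semidefinite. If $K$ is positive definite, then the system $(E,A,B,C,D)$ with $A=(J-R)Q$, $B=F-P$, $C=(F+P)^TQ$, $D=S+N$ is admissible and extended strictly positive real. Here $(E,A,B,C,D)$ is called *admissible* if the pair $(E,A)$ is regular, i.e. $\det(zE-A)\neq 0$ for some $z\in\mathbb C$; has index at most one; and is asymptotically stable, i.e. all roots $z\in\mathbb C$ of $\det(zE-A)$ satisfy $\operatorname{Re}z<0$. The *index* of a regular pair is the degree of nilpotency of $N_\infty$ in a Weierstrass form $E=W\begin{bmatrix}I_q&0\\0&N_\infty\end{bmatrix}T$,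 $A=W\begin{bmatrix}J_0&0\\0&I_{n-q}\end{bmatrix}T$ with $W,T\in\mathbb C^{n,n}$ nonsingular and $N_\infty$ nilpotent; it is $0$ if $E$ is nonsingular. A regular system with transfer function $G(s)=C(sE-A)^{-1}B+D$ (a matrix of rational functions) is called *strictly positive real* if $G$ has no pole in $\operatorname{Re}s\ge 0$ and $G(j\omega)+G(j\omega)^*\succ 0$ for all $\omega\in[0,\infty)$. It is called *extended strictly positive real* if in addition the limit $G(j\infty)=\lim_{\omega\to\infty}G(j\omega)$ exists and $G(j\infty)+G(j\infty)^*\succ 0$. -/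

import Mathlib

open scoped ComplexOrder

noncomputable section

/-- A linear time-invariant system `E x' = A x + B u`, `y = C x + D u` with `n` states,
`m` inputs and `m` outputs, given by its real coefficient matrices `(E, A, B, C, D)`. -/
structure LTISystem (n m : ℕ) where
  E : Matrix (Fin n) (Fin n) ℝ
  A : Matrix (Fin n) (Fin n) ℝ
  B : Matrix (Fin n) (Fin m) ℝ
  C : Matrix (Fin m) (Fin n) ℝ
  D : Matrix (Fin m) (Fin m) ℝ

/-- A real matrix regarded as a complex matrix. -/
def complexify {k l : ℕ} (M : Matrix (Fin k) (Fin l) ℝ) : Matrix (Fin k) (Fin l) ℂ :=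
  M.map (fun x : ℝ => (x : ℂ))

/-- A real matrix regarded as a matrix of constant rational functions over `ℂ`. -/
def constRat {k l : ℕ} (M : Matrix (Fin k) (Fin l) ℝ) : Matrix (Fin k) (Fin l) (RatFunc ℂ) :=
  M.map (fun x : ℝ => RatFunc.C (x : ℂ))

/-! ### Matrix pairs -/

/-- The pair `(E, A)` is regular: `det (z E - A) ≠ 0` for some complex `z`. -/
def IsRegularPair {n : ℕ} (E A : Matrix (Fin n) (Fin n) ℝ) : Prop :=
  ∃ z : ℂ, (z • complexify E - complexify A).det ≠ 0

/-- The finite eigenvalues of the pair `(E, A)`: the complex roots of `det (z E - A)`. -/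
def finiteEigenvalues {n : ℕ} (E A : Matrix (Fin n) (Fin n) ℝ) : Set ℂ :=
  {z : ℂ | (z • complexify E - complexify A).det = 0}

/-- All finite eigenvalues of `(E, A)` lie in the open left half plane.  (There are then none on
the imaginary axis, so no semisimplicity requirement remains.) -/
def IsAsymptoticallyStablePair {n : ℕ} (E A : Matrix (Fin n) (Fin n) ℝ) : Prop :=
  ∀ z ∈ finiteEigenvalues E A, z.re < 0

/-- The pair `(E, A)` has index `ν`: there are nonsingular complex matrices `W`, `T` with
`E = W diag(I_q, N) T` and `A = W diag(J, I_r) T`, `q + r = n`, where `N` is nilpotent and `ν` is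
its degree of nilpotency.  The bijection `e` only numbers the rows and columns of the block
matrices by `Fin n`.  When `r = 0`, that is, when `E` is nonsingular, `N` is the empty matrix,
which satisfies `N ^ 0 = 0`, so that `ν = 0`. -/
def HasIndex {n : ℕ} (E A : Matrix (Fin n) (Fin n) ℝ) (ν : ℕ) : Prop :=
  ∃ (q r : ℕ) (e : Fin q ⊕ Fin r ≃ Fin n) (W T : Matrix (Fin n) (Fin n) ℂ)
    (J : Matrix (Fin q) (Fin q) ℂ) (N : Matrix (Fin r) (Fin r) ℂ),
    IsUnit W ∧ IsUnit T ∧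
    complexify E = W * Matrix.reindex e e (Matrix.fromBlocks 1 0 0 N) * T ∧
    complexify A = W * Matrix.reindex e e (Matrix.fromBlocks J 0 0 1) * T ∧
    N ^ ν = 0 ∧ ∀ i < ν, N ^ i ≠ 0

/-- The pair `(E, A)` is admissible: regular, of index at most one, and asymptotically stable. -/
def IsAdmissiblePair {n : ℕ} (E A : Matrix (Fin n) (Fin n) ℝ) : Prop :=
  IsRegularPair E A ∧ (∃ ν ≤ 1, HasIndex E A ν) ∧ IsAsymptoticallyStablePair E A

/-! ### Transfer functions and positive realness -/

/-- `s` is a pole of some entry of the matrix `G` of rational functions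
(the denominator of a rational function is taken in lowest terms). -/
def IsPole {k l : ℕ} (G : Matrix (Fin k) (Fin l) (RatFunc ℂ)) (s : ℂ) : Prop :=
  ∃ i j, (G i j).denom.eval s = 0

/-- The value at `s` of a matrix of rational functions, for `s` not a pole. -/
def evalRat {k l : ℕ} (G : Matrix (Fin k) (Fin l) (RatFunc ℂ)) (s : ℂ) :
    Matrix (Fin k) (Fin l) ℂ :=
  G.map (fun g => g.eval (RingHom.id ℂ) s)

namespace LTISystem

variable {n m : ℕ}

/-- The system is regular. -/
def IsRegular (Sys : LTISystem n m) : Prop := IsRegularPair Sys.E Sys.A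

/-- The system is admissible. -/
def IsAdmissible (Sys : LTISystem n m) : Prop := IsAdmissiblePair Sys.E Sys.A

/-- The transfer function `G(s) = C (s E - A)⁻¹ B + D`, as a matrix of rational functions. -/
def transferFunction (Sys : LTISystem n m) : Matrix (Fin m) (Fin m) (RatFunc ℂ) :=
  constRat Sys.C * ((RatFunc.X : RatFunc ℂ) • constRat Sys.E - constRat Sys.A)⁻¹ * constRat Sys.B
    + constRat Sys.D

/-- The value `G(s)` of the transfer function. -/
def transferAt (Sys : LTISystem n m) (s : ℂ) : Matrix (Fin m) (Fin m) ℂ :=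
  evalRat Sys.transferFunction s

/-- Strictly positive real: the system is regular, its transfer function has no pole in
`Re s ≥ 0`, and `G(jω) + G(jω)^*` is positive definite for all `ω ∈ [0, ∞)`. -/
def IsSPR (Sys : LTISystem n m) : Prop :=
  Sys.IsRegular ∧
  (∀ s : ℂ, 0 ≤ s.re → ¬ IsPole Sys.transferFunction s) ∧
  ∀ ω : ℝ, 0 ≤ ω →
    (Sys.transferAt (Complex.I * ω) + (Sys.transferAt (Complex.I * ω)).conjTranspose).PosDef

/-- Extended strictly positive real: strictly positive real, and
`G(j∞) = lim_{ω → ∞} G(jω)` exists and `G(j∞) + G(j∞)^*` is positive definite. -/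
def IsESPR (Sys : LTISystem n m) : Prop :=
  Sys.IsSPR ∧
  ∃ Ginf : Matrix (Fin m) (Fin m) ℂ,
    Filter.Tendsto (fun ω : ℝ => Sys.transferAt (Complex.I * ω)) Filter.atTop (nhds Ginf) ∧
    (Ginf + Ginf.conjTranspose).PosDef

end LTISystem

/-! ### Port-Hamiltonian systems -/

/-- The data of a linear time-invariant input-state-output port-Hamiltonian system
`E x' = (J - R) Q x + (F - P) u`, `y = (F + P)ᵀ Q x + (S + N) u`, with the conditions
imposed on them. -/
structure PHSystem (n m : ℕ) where
  E : Matrix (Fin n) (Fin n) ℝ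
  J : Matrix (Fin n) (Fin n) ℝ
  R : Matrix (Fin n) (Fin n) ℝ
  Q : Matrix (Fin n) (Fin n) ℝ
  F : Matrix (Fin n) (Fin m) ℝ
  P : Matrix (Fin n) (Fin m) ℝ
  S : Matrix (Fin m) (Fin m) ℝ
  N : Matrix (Fin m) (Fin m) ℝ
  Q_invertible : IsUnit Q
  QE_symm : Q.transpose * E = E.transpose * Q
  QE_posSemidef : (Q.transpose * E).PosSemidef
  J_skew : J.transpose = -J
  R_posSemidef : R.PosSemidef
  S_posSemidef : S.PosSemidef
  N_skew : N.transpose = -N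
  K_posSemidef : (Matrix.fromBlocks R P P.transpose S).PosSemidef

namespace PHSystem

variable {n m : ℕ}

/-- The cost matrix `K = [[R, P], [Pᵀ, S]]`. -/
def costMatrix (H : PHSystem n m) : Matrix (Fin n ⊕ Fin m) (Fin n ⊕ Fin m) ℝ :=
  Matrix.fromBlocks H.R H.P H.P.transpose H.S

/-- The system `(E, (J - R) Q, F - P, (F + P)ᵀ Q, S + N)`. -/
def toLTISystem (H : PHSystem n m) : LTISystem n m where
  E := H.E
  A := (H.J - H.R) * H.Q
  B := H.F - H.P
  C := (H.F + H.P).transpose * H.Q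
  D := H.S + H.N

end PHSystem

end

/-! In the effort variable `Q x` the pencil factors as `zE - A = (z M - (J - R)) Q`, where `M = E
Q⁻¹ = Q⁻ᵀ (Qᵀ E) Q⁻¹ ⪰ 0`. The first factor plus its adjoint is `2 Re z • M + 2R`, and `R ≻ 0` as a
diagonal block of `K`. Hence the pencil is invertible for `Re z ≥ 0`, which gives regularity,
stability and the absence of poles there.

For the index, diagonalise `M`. The compression of `J - R` to `ker M` has negative definite
Hermitian part, so it is invertible, and a Schur complement yields a Weierstrass form with zero
nilpotent block (`exists_weierstrass_form_of_posSemidef`).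

For positivity, put `Z(s) = (s M - (J - R))⁻¹ (F - P)`. On the imaginary axis `power_balance` turns
`G + Gᴴ` into `2 [Z; 1]ᴴ K [Z; 1] ≻ 0` (`posDef_add_conjTranspose_of_posDef_fromBlocks`). The
Weierstrass form makes `Z(jω)` converge as `ω → ∞`; the balance is a closed condition, so the same
identity gives positivity at infinity. -/

open scoped MatrixOrder in
/-- The complexification of a positive semidefinite real matrix is positive semidefinite. -/
theorem Matrix.PosSemidef.map_ofReal {ι : Type*} [Fintype ι] {M : Matrix ι ι ℝ}
    (hM : M.PosSemidef) : (M.map (fun x : ℝ => (x : ℂ))).PosSemidef := by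
  classical
  obtain ⟨B, rfl⟩ := CStarAlgebra.nonneg_iff_eq_star_mul_self.mp hM.nonneg
  have h : (star B * B).map (fun x : ℝ => (x : ℂ))
      = (B.map (fun x : ℝ => (x : ℂ))).conjTranspose * B.map (fun x : ℝ => (x : ℂ)) := by
    ext i j
    simp [Matrix.mul_apply]
  rw [h]
  exact Matrix.posSemidef_conjTranspose_mul_self _

/-- The complexification of a positive definite real matrix is positive definite. -/
theorem Matrix.PosDef.map_ofReal {ι : Type*} [Fintype ι] {M : Matrix ι ι ℝ}
    (hM : M.PosDef) : (M.map (fun x : ℝ => (x : ℂ))).PosDef := by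
  classical
  rw [hM.posSemidef.map_ofReal.posDef_iff_isUnit]
  exact hM.isUnit.map (Complex.ofRealHom.mapMatrix (m := ι))

/-- A complex matrix with positive definite Hermitian part is invertible. -/
theorem Matrix.isUnit_of_posDef_add_conjTranspose {ι : Type*} [Fintype ι] [DecidableEq ι]
    {X : Matrix ι ι ℂ} (hX : (X + X.conjTranspose).PosDef) : IsUnit X := by
  rw [← Matrix.mulVec_injective_iff_isUnit]
  refine (injective_iff_map_eq_zero X.mulVecLin).mpr fun v hv => ?_
  by_contra hne
  have hv' : X.mulVec v = 0 := hv
  have h := hX.dotProduct_mulVec_pos hne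
  rw [Matrix.add_mulVec, dotProduct_add, hv', dotProduct_zero, zero_add,
    Matrix.dotProduct_mulVec, ← Matrix.star_mulVec, hv'] at h
  simp at h

/-! ### Weierstrass form and the resolvent at infinity -/

/-- Weierstrass form of `(H, M)`, of index at most one, when `H` is positive semidefinite and the
Hermitian part of `M` is negative definite. -/
theorem exists_weierstrass_form_of_posSemidef {n : ℕ} {H M : Matrix (Fin n) (Fin n) ℂ}
    (hH : H.PosSemidef) (hM : (-M + (-M).conjTranspose).PosDef) :
    ∃ (q r : ℕ) (e : Fin q ⊕ Fin r ≃ Fin n) (W T : Matrix (Fin n) (Fin n) ℂ)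
      (J : Matrix (Fin q) (Fin q) ℂ), IsUnit W ∧ IsUnit T ∧
      H = W * Matrix.reindex e e (Matrix.fromBlocks 1 0 0 0) * T ∧
      M = W * Matrix.reindex e e (Matrix.fromBlocks J 0 0 1) * T := by
  classical
  set l := hH.isHermitian.eigenvalues with hl
  let U : Matrix (Fin n) (Fin n) ℂ := hH.isHermitian.eigenvectorUnitary
  have hU1 : U.conjTranspose * U = 1 :=
    Unitary.coe_star_mul_self hH.isHermitian.eigenvectorUnitary
  have hU2 : U * U.conjTranspose = 1 :=
    Unitary.coe_mul_star_self hH.isHermitian.eigenvectorUnitary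
  have hUu : IsUnit U := ⟨⟨U, _, hU2, hU1⟩, rfl⟩
  have hUu' : IsUnit U.conjTranspose := ⟨⟨_, U, hU1, hU2⟩, rfl⟩
  have hspec : H = U * Matrix.diagonal (fun i => (l i : ℂ)) * U.conjTranspose :=
    hH.isHermitian.spectral_theorem
  -- Nonzero eigenvalues come first, so the second block is the kernel of `H`.
  let e : Fin (Fintype.card {i // l i ≠ 0}) ⊕ Fin (Fintype.card {i // ¬ l i ≠ 0}) ≃ Fin n :=
    (Equiv.sumCongr (Fintype.equivFin _).symm (Fintype.equivFin _).symm).trans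
      (Equiv.sumCompl fun i => l i ≠ 0)
  have he1 : ∀ i, l (e (Sum.inl i)) ≠ 0 := fun i => ((Fintype.equivFin _).symm i).2
  have he2 : ∀ i, l (e (Sum.inr i)) = 0 := fun i =>
    not_not.mp ((Fintype.equivFin {i // ¬ l i ≠ 0}).symm i).2
  let ρ := Matrix.reindexAlgEquiv ℂ ℂ e
  let Λ : Matrix (Fin (Fintype.card {i // l i ≠ 0})) (Fin (Fintype.card {i // l i ≠ 0})) ℂ :=
    Matrix.diagonal fun i => (l (e (Sum.inl i)) : ℂ)
  have hΛ : IsUnit Λ := by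
    rw [Matrix.isUnit_diagonal, Pi.isUnit_iff]
    exact fun i => isUnit_iff_ne_zero.mpr (Complex.ofReal_ne_zero.mpr (he1 i))
  have hD : Matrix.diagonal (fun i => (l i : ℂ)) = ρ (Matrix.fromBlocks Λ 0 0 0) := by
    rw [← AlgEquiv.symm_apply_eq]
    ext (i | i) (j | j)
    · simp [ρ, Λ, Matrix.diagonal_apply]
    · simp [ρ]
    · simp [ρ]
    · simp [ρ, Matrix.diagonal_apply, he2]
  let X := ρ.symm (U.conjTranspose * M * U)
  have hMX : M = U * ρ X * U.conjTranspose := by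
    simp only [X, AlgEquiv.apply_symm_apply]
    calc M = (U * U.conjTranspose) * M * (U * U.conjTranspose) := by simp [hU2]
      _ = _ := by simp only [Matrix.mul_assoc]
  -- This block is the compression of `M` to `ker H`; definiteness passes to principal submatrices.
  have hd : IsUnit X.toBlocks₂₂ := by
    rw [← IsUnit.neg_iff]
    apply Matrix.isUnit_of_posDef_add_conjTranspose
    have h1 : (U.conjTranspose * (-M + (-M).conjTranspose) * U).PosDef :=
      hM.conjTranspose_mul_mul_same (Matrix.mulVec_injective_of_isUnit hUu)
    have h2 := h1.submatrix (e := fun i => e (Sum.inr i))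
      (e.injective.comp Sum.inr_injective)
    convert h2 using 1
    have h3 : U.conjTranspose * (-M + (-M).conjTranspose) * U
        = -(U.conjTranspose * M * U) + (-(U.conjTranspose * M * U)).conjTranspose := by
      simp [Matrix.mul_add, Matrix.add_mul, Matrix.mul_assoc]
    rw [h3]
    rfl
  have := hd.invertible
  obtain ⟨a, b, c, d, hX⟩ : ∃ a b c d, X = Matrix.fromBlocks a b c d :=
    ⟨_, _, _, _, (Matrix.fromBlocks_toBlocks X).symm⟩
  rw [hX, Matrix.toBlocks_fromBlocks₂₂] at hd
  have := hd.invertible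
  have := hΛ.invertible
  rw [Matrix.fromBlocks_eq_of_invertible₂₂] at hX
  -- Block LDU factorisation of `X` around `d`. Both unipotent factors leave `diag(Λ, 0)` unchanged,
  -- so they bring `M` to block diagonal form without disturbing `H`.
  refine ⟨_, _, e, U * ρ (Matrix.fromBlocks 1 (b * ⅟d) 0 1 * Matrix.fromBlocks Λ 0 0 d),
    ρ (Matrix.fromBlocks 1 0 (⅟d * c) 1) * U.conjTranspose, ⅟Λ * (a - b * ⅟d * c), ?_, ?_, ?_, ?_⟩
  · refine hUu.mul (IsUnit.map ρ (IsUnit.mul ?_ ?_))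
    · simp
    · simp [hΛ, hd]
  · refine (IsUnit.map ρ ?_).mul hUu'
    simp
  · rw [hspec, hD]
    change _ = _ * ρ _ * _
    simp only [Matrix.mul_assoc, ← mul_assoc (ρ _) (ρ _), ← map_mul]
    simp [Matrix.fromBlocks_multiply]
  · rw [hMX, hX]
    change _ = _ * ρ _ * _
    simp only [Matrix.mul_assoc, ← mul_assoc (ρ _) (ρ _), ← map_mul]
    simp [Matrix.fromBlocks_multiply]

/-- Along the imaginary axis the resolvent of a regular pair of index at most one converges. -/
theorem exists_tendsto_inv_of_weierstrass_form {n q r : ℕ} (e : Fin q ⊕ Fin r ≃ Fin n)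
    {W T : Matrix (Fin n) (Fin n) ℂ} (J : Matrix (Fin q) (Fin q) ℂ)
    (hu : ∀ ω : ℝ, IsUnit ((Complex.I * ω) •
      (W * Matrix.reindex e e (Matrix.fromBlocks 1 0 0 0) * T)
        - W * Matrix.reindex e e (Matrix.fromBlocks J 0 0 1) * T)) :
    ∃ Y : Matrix (Fin n) (Fin n) ℂ, Filter.Tendsto (fun ω : ℝ => ((Complex.I * ω) •
      (W * Matrix.reindex e e (Matrix.fromBlocks 1 0 0 0) * T)
        - W * Matrix.reindex e e (Matrix.fromBlocks J 0 0 1) * T)⁻¹) Filter.atTop (nhds Y) := by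
  have hres : Filter.Tendsto (fun ω : ℝ => ((Complex.I * ω) • (1 : Matrix (Fin q) (Fin q) ℂ)
      - J)⁻¹) Filter.atTop (nhds 0) := by
    let : NormedRing (Matrix (Fin q) (Fin q) ℂ) := Matrix.linftyOpNormedRing
    let : NormedAlgebra ℂ (Matrix (Fin q) (Fin q) ℂ) := Matrix.linftyOpNormedAlgebra
    have h1 := spectrum.resolvent_tendsto_cobounded (𝕜 := ℂ) J
    have h2 : Filter.Tendsto (fun ω : ℝ => Complex.I * ω) Filter.atTop (Bornology.cobounded ℂ) := by
      rw [← tendsto_norm_atTop_iff_cobounded]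
      simpa using Filter.tendsto_abs_atTop_atTop
    refine (h1.comp h2).congr fun ω => ?_
    simp [resolvent, Matrix.nonsing_inv_eq_ringInverse, Algebra.algebraMap_eq_smul_one]
  have hfac : ∀ ω : ℝ, (Complex.I * ω) •
      (W * Matrix.reindex e e (Matrix.fromBlocks 1 0 0 0) * T)
        - W * Matrix.reindex e e (Matrix.fromBlocks J 0 0 1) * T
      = W * Matrix.reindex e e (Matrix.fromBlocks ((Complex.I * ω) • 1 - J) 0 0 (-1)) * T := by
    intro ω
    rw [← Matrix.smul_mul, ← Matrix.mul_smul, ← Matrix.sub_mul, ← Matrix.mul_sub]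
    congr 2
    change _ • Matrix.reindexAlgEquiv ℂ ℂ e _ - Matrix.reindexAlgEquiv ℂ ℂ e _
      = Matrix.reindexAlgEquiv ℂ ℂ e _
    rw [← map_smul, ← map_sub, Matrix.fromBlocks_smul, sub_eq_add_neg, Matrix.fromBlocks_neg,
      Matrix.fromBlocks_add]
    simp [sub_eq_add_neg]
  -- The resolvent of `J` decays, while the block `-1` is independent of `ω` because the nilpotent
  -- part vanishes.
  refine ⟨T⁻¹ * (Matrix.reindex e e (Matrix.fromBlocks 0 0 0 (-1)) * W⁻¹), ?_⟩
  have hinv : ∀ ω : ℝ, ((Complex.I * ω) •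
      (W * Matrix.reindex e e (Matrix.fromBlocks 1 0 0 0) * T)
        - W * Matrix.reindex e e (Matrix.fromBlocks J 0 0 1) * T)⁻¹
      = T⁻¹ * (Matrix.reindex e e
        (Matrix.fromBlocks ((Complex.I * ω) • 1 - J)⁻¹ 0 0 (-1)) * W⁻¹) := by
    intro ω
    have h := hu ω
    rw [hfac] at h ⊢
    have h1 : IsUnit (Matrix.fromBlocks ((Complex.I * (ω : ℂ)) • 1 - J) 0 0
        (-1 : Matrix (Fin r) (Fin r) ℂ)) := by
      rw [Matrix.isUnit_iff_isUnit_det] at h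
      rw [Matrix.det_mul, Matrix.det_mul, IsUnit.mul_iff, IsUnit.mul_iff,
        ← Matrix.isUnit_iff_isUnit_det (Matrix.reindex e e _)] at h
      replace h := h.1.2
      exact (MulEquiv.isUnit_map (Matrix.reindexAlgEquiv ℂ ℂ e)).mp h
    rw [Matrix.isUnit_fromBlocks_zero₁₂] at h1
    rw [Matrix.mul_inv_rev, Matrix.mul_inv_rev, Matrix.inv_reindex,
      Matrix.inv_fromBlocks_zero₁₂_of_isUnit_iff _ _ _ (by simp [h1.1])]
    have h2 : (-1 : Matrix (Fin r) (Fin r) ℂ)⁻¹ = -1 := Matrix.inv_eq_left_inv (by simp)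
    simp [h2]
  simp_rw [hinv]
  have hc : Continuous fun Z : Matrix (Fin q) (Fin q) ℂ => T⁻¹ * (Matrix.reindex e e
      (Matrix.fromBlocks Z 0 0 (-1 : Matrix (Fin r) (Fin r) ℂ)) * W⁻¹) := by
    refine continuous_const.matrix_mul (Continuous.matrix_mul ?_ continuous_const)
    exact (Continuous.matrix_fromBlocks continuous_id continuous_const continuous_const
      continuous_const).matrix_submatrix _ _
  exact (hc.tendsto 0).comp hres

/-- Under the power balance `hZ`, the Hermitian part of `(F + P)ᴴ Z + S + N` is the
compression of the cost matrix `[[R, P], [Pᴴ, S]]` to the range of `[Z; 1]`; in particular it is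
positive definite if the cost matrix is. -/
theorem posDef_add_conjTranspose_of_posDef_fromBlocks {ι κ : Type*} [Fintype ι] [Fintype κ]
    [DecidableEq κ] {R : Matrix ι ι ℂ} {F P Z : Matrix ι κ ℂ} {S N : Matrix κ κ ℂ}
    (hK : (Matrix.fromBlocks R P P.conjTranspose S).PosDef)
    (hN : N.conjTranspose = -N)
    (hZ : Z.conjTranspose * (F - P) + (F - P).conjTranspose * Z
      = (2 : ℝ) • (Z.conjTranspose * R * Z)) :
    (((F + P).conjTranspose * Z + (S + N)) +
      ((F + P).conjTranspose * Z + (S + N)).conjTranspose).PosDef := by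
  have hS : S.conjTranspose = S := by
    have := hK.isHermitian
    rw [Matrix.isHermitian_fromBlocks_iff] at this
    exact this.2.2.2
  have hinj : Function.Injective (Matrix.fromRows Z (1 : Matrix κ κ ℂ)).mulVec := by
    intro v w h
    simp only [Matrix.fromRows_mulVec, Matrix.one_mulVec] at h
    funext i
    exact congrFun h (Sum.inr i)
  have h := (hK.conjTranspose_mul_mul_same hinj).smul (show (0 : ℝ) < 2 by norm_num)
  convert h using 1
  rw [Matrix.conjTranspose_fromRows_eq_fromCols_conjTranspose, Matrix.mul_assoc,
    Matrix.fromBlocks_mul_fromRows, Matrix.fromCols_mul_fromRows]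
  simp only [Matrix.conjTranspose_sub, Matrix.sub_mul, Matrix.mul_sub] at hZ
  simp only [Matrix.mul_add, ← Matrix.mul_assoc, Matrix.conjTranspose_add,
    Matrix.conjTranspose_mul, Matrix.add_mul, Matrix.conjTranspose_one, Matrix.mul_one,
    Matrix.one_mul, Matrix.conjTranspose_conjTranspose, hS, hN]
  -- `(F + P)ᴴ Z + Zᴴ (F + P)` exceeds the left side of `hZ` by `2 (Pᴴ Z + Zᴴ P)`, the off-diagonal
  -- contribution of the cost matrix; `N` cancels.
  linear_combination (norm := module) hZ

/-! ### Poles and values of the transfer function -/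

/-- Evaluation of a quotient of polynomials as a rational function. -/
theorem RatFunc.eval_algebraMap_div {K : Type*} [Field K] {p q : Polynomial K} {s : K}
    (hq : q.eval s ≠ 0) :
    (algebraMap (Polynomial K) (RatFunc K) p / algebraMap (Polynomial K) (RatFunc K) q).eval
      (RingHom.id K) s = p.eval s / q.eval s := by
  have hq0 : q ≠ 0 := by rintro rfl; simp at hq
  have hq' : algebraMap (Polynomial K) (RatFunc K) q ≠ 0 := RatFunc.algebraMap_ne_zero hq0
  set x := algebraMap (Polynomial K) (RatFunc K) p / algebraMap (Polynomial K) (RatFunc K) q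
    with hx
  have hden : Polynomial.eval₂ (RingHom.id K) s x.denom ≠ 0 := fun h =>
    hq (Polynomial.eval₂_eq_zero_of_dvd_of_eval₂_eq_zero (RingHom.id K) s
      (RatFunc.denom_div_dvd p q) h)
  have h1 := RatFunc.eval_mul (RingHom.id K) s (x := x)
    (y := algebraMap (Polynomial K) (RatFunc K) q) hden (by simp [RatFunc.denom_algebraMap])
  rw [hx, div_mul_cancel₀ _ hq', ← hx, RatFunc.eval_algebraMap, RatFunc.eval_algebraMap] at h1
  rw [eq_div_iff hq]
  simpa using h1.symm

namespace LTISystem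

variable {n m : ℕ}

/-- The polynomial matrix `X E - A`. -/
noncomputable def pencil (Sys : LTISystem n m) : Matrix (Fin n) (Fin n) (Polynomial ℂ) :=
  (Polynomial.X : Polynomial ℂ) • (complexify Sys.E).map Polynomial.C
    - (complexify Sys.A).map Polynomial.C

/-- The polynomial matrix `C adj(X E - A) B + det(X E - A) D`. -/
noncomputable def transferNumerator (Sys : LTISystem n m) : Matrix (Fin m) (Fin m) (Polynomial ℂ) :=
  (complexify Sys.C).map Polynomial.C * Sys.pencil.adjugate * (complexify Sys.B).map Polynomial.C
    + Sys.pencil.det • (complexify Sys.D).map Polynomial.C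

theorem map_eval_pencil (Sys : LTISystem n m) (s : ℂ) :
    (Polynomial.evalRingHom s).mapMatrix Sys.pencil
      = s • complexify Sys.E - complexify Sys.A := by
  ext i j
  simp only [pencil, RingHom.mapMatrix_apply, Matrix.map_apply, Matrix.sub_apply,
    Matrix.smul_apply, smul_eq_mul, map_sub, Polynomial.coe_evalRingHom,
    Polynomial.eval_mul, Polynomial.eval_X, Polynomial.eval_C]

theorem eval_det_pencil (Sys : LTISystem n m) (s : ℂ) :
    Sys.pencil.det.eval s = (s • complexify Sys.E - complexify Sys.A).det := by
  rw [← map_eval_pencil, ← RingHom.map_det]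
  rfl

theorem eval_transferNumerator (Sys : LTISystem n m) (s : ℂ) :
    Sys.transferNumerator.map (Polynomial.eval s)
      = complexify Sys.C * (s • complexify Sys.E - complexify Sys.A).adjugate * complexify Sys.B
        + (s • complexify Sys.E - complexify Sys.A).det • complexify Sys.D := by
  rw [← map_eval_pencil, ← RingHom.map_adjugate, map_eval_pencil, ← eval_det_pencil]
  ext i j
  simp [transferNumerator, Matrix.mul_apply, Polynomial.eval_finsetSum]

/-- Cramer's rule. The quotient need not be in lowest terms, but the reduced denominator divides
`det (X E - A)`, which suffices to locate poles and evaluate. -/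
theorem transferFunction_apply (Sys : LTISystem n m) (h : Sys.pencil.det ≠ 0) (i j : Fin m) :
    Sys.transferFunction i j
      = algebraMap (Polynomial ℂ) (RatFunc ℂ) (Sys.transferNumerator i j)
        / algebraMap (Polynomial ℂ) (RatFunc ℂ) Sys.pencil.det := by
  let φ := algebraMap (Polynomial ℂ) (RatFunc ℂ)
  have hd : φ Sys.pencil.det ≠ 0 := RatFunc.algebraMap_ne_zero h
  have hc : ∀ {k l : ℕ} (M : Matrix (Fin k) (Fin l) ℝ),
      constRat M = ((complexify M).map Polynomial.C).map φ := by
    intro k l M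
    ext i j
    simp [constRat, complexify, φ]
  have hp : (RatFunc.X : RatFunc ℂ) • constRat Sys.E - constRat Sys.A = φ.mapMatrix Sys.pencil := by
    ext i j
    simp only [pencil, hc, φ, RingHom.mapMatrix_apply, Matrix.map_apply, Matrix.sub_apply,
      Matrix.smul_apply, smul_eq_mul, map_sub, map_mul, RatFunc.algebraMap_X]
  have hmain : φ Sys.pencil.det • Sys.transferFunction = Sys.transferNumerator.map φ := by
    rw [transferFunction, hp, Matrix.inv_def, ← RingHom.map_det, ← RingHom.map_adjugate,
      Ring.inverse_eq_inv', Matrix.mul_smul, Matrix.smul_mul, smul_add, smul_smul,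
      mul_inv_cancel₀ hd, one_smul, hc, hc, hc]
    ext i j
    simp [transferNumerator, Matrix.mul_apply]
  rw [eq_div_iff hd, mul_comm]
  exact congrFun (congrFun hmain i) j

theorem not_isPole_transferFunction (Sys : LTISystem n m) {s : ℂ}
    (hs : (s • complexify Sys.E - complexify Sys.A).det ≠ 0) :
    ¬ IsPole Sys.transferFunction s := by
  rintro ⟨i, j, hij⟩
  rw [← eval_det_pencil] at hs
  have h0 : Sys.pencil.det ≠ 0 := fun h => hs (by rw [h, Polynomial.eval_zero])
  rw [Sys.transferFunction_apply h0] at hij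
  exact hs (Polynomial.eval_eq_zero_of_dvd_of_eval_eq_zero (RatFunc.denom_div_dvd _ _) hij)

theorem transferAt_eq (Sys : LTISystem n m) {s : ℂ}
    (hs : (s • complexify Sys.E - complexify Sys.A).det ≠ 0) :
    Sys.transferAt s
      = complexify Sys.C * (s • complexify Sys.E - complexify Sys.A)⁻¹ * complexify Sys.B
        + complexify Sys.D := by
  have hs' := hs
  rw [← eval_det_pencil] at hs'
  have h0 : Sys.pencil.det ≠ 0 := fun h => hs' (by rw [h, Polynomial.eval_zero])
  have h1 : (s • complexify Sys.E - complexify Sys.A).det • Sys.transferAt s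
      = Sys.transferNumerator.map (Polynomial.eval s) := by
    ext i j
    rw [Matrix.smul_apply, transferAt, evalRat, Matrix.map_apply, Sys.transferFunction_apply h0,
      RatFunc.eval_algebraMap_div hs', Matrix.map_apply, eval_det_pencil, smul_eq_mul,
      mul_div_cancel₀ _ hs]
  rw [eval_transferNumerator] at h1
  refine smul_right_injective _ hs (h1.trans ?_)
  simp only [smul_add]
  rw [Matrix.inv_def, Ring.inverse_eq_inv', Matrix.mul_smul, Matrix.smul_mul, smul_smul,
    mul_inv_cancel₀ hs, one_smul]

end LTISystem

/-! ### Complexification -/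

theorem complexify_mul {k l p : ℕ} (M : Matrix (Fin k) (Fin l) ℝ) (N : Matrix (Fin l) (Fin p) ℝ) :
    complexify (M * N) = complexify M * complexify N :=
  Matrix.map_mul (f := Complex.ofRealHom)

theorem complexify_add {k l : ℕ} (M N : Matrix (Fin k) (Fin l) ℝ) :
    complexify (M + N) = complexify M + complexify N := by
  ext i j; simp [complexify]

theorem complexify_sub {k l : ℕ} (M N : Matrix (Fin k) (Fin l) ℝ) :
    complexify (M - N) = complexify M - complexify N := by
  ext i j; simp [complexify]

theorem complexify_neg {k l : ℕ} (M : Matrix (Fin k) (Fin l) ℝ) :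
    complexify (-M) = -complexify M := by
  ext i j; simp [complexify]

theorem complexify_transpose {k l : ℕ} (M : Matrix (Fin k) (Fin l) ℝ) :
    complexify M.transpose = (complexify M).conjTranspose := by
  ext i j; simp [complexify]

theorem isUnit_complexify {k : ℕ} {M : Matrix (Fin k) (Fin k) ℝ} (hM : IsUnit M) :
    IsUnit (complexify M) :=
  hM.map (Complex.ofRealHom.mapMatrix (m := Fin k))

/-! ### Port-Hamiltonian systems -/

namespace PHSystem

variable {n m : ℕ} (H : PHSystem n m)

/-- The Hamiltonian matrix `E Q⁻¹` in the effort coordinates `Q x`, complexified. -/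
noncomputable def effortMatrix : Matrix (Fin n) (Fin n) ℂ := complexify (H.E * H.Q⁻¹)

/-- Congruence of `Qᵀ E` by `Q⁻¹`. -/
theorem effortMatrix_posSemidef : H.effortMatrix.PosSemidef := by
  have h := (H.QE_posSemidef.conjTranspose_mul_mul_same H.Q⁻¹).map_ofReal
  have hQ : IsUnit H.Q.transpose.det := by
    rw [Matrix.det_transpose]
    exact (Matrix.isUnit_iff_isUnit_det _).mp H.Q_invertible
  rwa [Matrix.conjTranspose_eq_transpose_of_trivial, Matrix.transpose_nonsing_inv,
    ← Matrix.mul_assoc, Matrix.nonsing_inv_mul _ hQ, Matrix.one_mul] at h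

theorem complexify_E : complexify H.E = H.effortMatrix * complexify H.Q := by
  rw [effortMatrix, ← complexify_mul, Matrix.mul_assoc,
    Matrix.nonsing_inv_mul _ ((Matrix.isUnit_iff_isUnit_det _).mp H.Q_invertible), Matrix.mul_one]

theorem pencil_eq (s : ℂ) :
    s • complexify H.toLTISystem.E - complexify H.toLTISystem.A
      = (s • H.effortMatrix - complexify (H.J - H.R)) * complexify H.Q := by
  rw [Matrix.sub_mul, Matrix.smul_mul, ← complexify_E, ← complexify_mul]
  rfl

theorem conjTranspose_complexify_J : (complexify H.J).conjTranspose = -complexify H.J := by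
  rw [← complexify_transpose, H.J_skew, complexify_neg]

theorem conjTranspose_complexify_R : (complexify H.R).conjTranspose = complexify H.R :=
  H.R_posSemidef.map_ofReal.isHermitian

/-- The Hermitian part of `s E Q⁻¹ - (J - R)` is `Re s • E Q⁻¹ + R`. -/
theorem pencil_add_conjTranspose (s : ℂ) :
    (s • H.effortMatrix - complexify (H.J - H.R)) +
      (s • H.effortMatrix - complexify (H.J - H.R)).conjTranspose
      = (2 * s.re) • H.effortMatrix + (2 : ℝ) • complexify H.R := by
  have hs : (s + star s) • H.effortMatrix = (2 * s.re) • H.effortMatrix := by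
    rw [Complex.star_def, Complex.add_conj]
    ext i j; simp
  rw [← hs, complexify_sub]
  simp only [Matrix.conjTranspose_sub, Matrix.conjTranspose_smul,
    H.effortMatrix_posSemidef.isHermitian.eq, conjTranspose_complexify_J,
    conjTranspose_complexify_R]
  module

variable {H}

theorem complexify_R_posDef (hK : H.costMatrix.PosDef) : (complexify H.R).PosDef :=
  (hK.submatrix Sum.inl_injective).map_ofReal

theorem isUnit_effort_pencil (hK : H.costMatrix.PosDef) {s : ℂ} (hs : 0 ≤ s.re) :
    IsUnit (s • H.effortMatrix - complexify (H.J - H.R)) := by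
  apply Matrix.isUnit_of_posDef_add_conjTranspose
  rw [pencil_add_conjTranspose]
  exact Matrix.PosDef.posSemidef_add (H.effortMatrix_posSemidef.smul (by positivity))
    ((complexify_R_posDef hK).smul two_pos)

theorem det_pencil_ne_zero (hK : H.costMatrix.PosDef) {s : ℂ} (hs : 0 ≤ s.re) :
    (s • complexify H.toLTISystem.E - complexify H.toLTISystem.A).det ≠ 0 := by
  rw [pencil_eq]
  exact ((Matrix.isUnit_iff_isUnit_det _).mp
    ((isUnit_effort_pencil hK hs).mul (isUnit_complexify H.Q_invertible))).ne_zero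

theorem exists_weierstrass_form (hK : H.costMatrix.PosDef) :
    ∃ (q r : ℕ) (e : Fin q ⊕ Fin r ≃ Fin n) (W T : Matrix (Fin n) (Fin n) ℂ)
      (J : Matrix (Fin q) (Fin q) ℂ), IsUnit W ∧ IsUnit T ∧
      H.effortMatrix = W * Matrix.reindex e e (Matrix.fromBlocks 1 0 0 0) * T ∧
      complexify (H.J - H.R) = W * Matrix.reindex e e (Matrix.fromBlocks J 0 0 1) * T := by
  refine exists_weierstrass_form_of_posSemidef H.effortMatrix_posSemidef ?_
  have h := H.pencil_add_conjTranspose 0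
  simp only [zero_smul, zero_sub, Complex.zero_re, mul_zero, zero_add] at h
  rw [h]
  exact (complexify_R_posDef hK).smul two_pos

theorem isRegularPair (hK : H.costMatrix.PosDef) :
    IsRegularPair H.toLTISystem.E H.toLTISystem.A :=
  ⟨0, det_pencil_ne_zero hK le_rfl⟩

theorem isAdmissible (hK : H.costMatrix.PosDef) : H.toLTISystem.IsAdmissible := by
  refine ⟨isRegularPair hK, ?_, fun z hz => ?_⟩
  · obtain ⟨q, r, e, W, T, J, hW, hT, hE, hA⟩ := exists_weierstrass_form hK
    have hE' : complexify H.toLTISystem.E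
        = W * Matrix.reindex e e (Matrix.fromBlocks 1 0 0 0) * (T * complexify H.Q) := by
      rw [← Matrix.mul_assoc, ← hE]
      exact H.complexify_E
    have hA' : complexify H.toLTISystem.A
        = W * Matrix.reindex e e (Matrix.fromBlocks J 0 0 1) * (T * complexify H.Q) := by
      rw [← Matrix.mul_assoc, ← hA]
      exact complexify_mul _ _
    have hT' := hT.mul (isUnit_complexify H.Q_invertible)
    -- The zero nilpotent block has degree 0 if it is empty and degree 1 otherwise.
    rcases Nat.eq_zero_or_pos r with rfl | hr
    · exact ⟨0, zero_le_one, q, 0, e, W, _, J, 0, hW, hT', hE', hA', Subsingleton.elim _ _, by simp⟩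
    · have : Nonempty (Fin r) := ⟨⟨0, hr⟩⟩
      exact ⟨1, le_rfl, q, r, e, W, _, J, 0, hW, hT', hE', hA', pow_one _, by simp⟩
  · by_contra hre
    exact det_pencil_ne_zero hK (not_lt.mp hre) hz

theorem transferAt_eq (hK : H.costMatrix.PosDef) {s : ℂ} (hs : 0 ≤ s.re) :
    H.toLTISystem.transferAt s
      = (complexify H.F + complexify H.P).conjTranspose *
          ((s • H.effortMatrix - complexify (H.J - H.R))⁻¹ * (complexify H.F - complexify H.P))
        + (complexify H.S + complexify H.N) := by
  rw [H.toLTISystem.transferAt_eq (det_pencil_ne_zero hK hs), pencil_eq, Matrix.mul_inv_rev]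
  have hC : complexify H.toLTISystem.C
      = (complexify H.F + complexify H.P).conjTranspose * complexify H.Q := by
    rw [← complexify_add, ← complexify_transpose, ← complexify_mul]
    rfl
  have hB : complexify H.toLTISystem.B = complexify H.F - complexify H.P := complexify_sub _ _
  have hD : complexify H.toLTISystem.D = complexify H.S + complexify H.N := complexify_add _ _
  rw [hC, hB, hD, Matrix.mul_assoc _ (complexify H.Q), Matrix.mul_nonsing_inv_cancel_left _ _
    ((Matrix.isUnit_iff_isUnit_det _).mp (isUnit_complexify H.Q_invertible)), Matrix.mul_assoc]

/-- On the imaginary axis, the supplied power equals the dissipated power. -/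
theorem power_balance (hK : H.costMatrix.PosDef) {s : ℂ} (hs : s.re = 0) :
    let Z := (s • H.effortMatrix - complexify (H.J - H.R))⁻¹ * (complexify H.F - complexify H.P)
    Z.conjTranspose * (complexify H.F - complexify H.P)
      + (complexify H.F - complexify H.P).conjTranspose * Z
      = (2 : ℝ) • (Z.conjTranspose * complexify H.R * Z) := by
  intro Z
  have h := H.pencil_add_conjTranspose s
  rw [hs, mul_zero, zero_smul, zero_add] at h
  have hZ : (s • H.effortMatrix - complexify (H.J - H.R)) * Z
      = complexify H.F - complexify H.P :=
    Matrix.mul_nonsing_inv_cancel_left _ _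
      ((Matrix.isUnit_iff_isUnit_det _).mp (isUnit_effort_pencil hK hs.ge))
  clear_value Z
  -- With `X` the pencil and `X Z = F - P`, both sides equal `Zᴴ (X + Xᴴ) Z`.
  rw [← Matrix.smul_mul, ← Matrix.mul_smul, ← h, Matrix.mul_add, Matrix.add_mul, ← hZ,
    Matrix.conjTranspose_mul]
  simp only [Matrix.mul_assoc]

/-- Only the balance is required of `Z`, so that the limit of `Z(jω)` is covered as well. -/
theorem posDef_of_power_balance (hK : H.costMatrix.PosDef) {Z : Matrix (Fin n) (Fin m) ℂ}
    (hZ : Z.conjTranspose * (complexify H.F - complexify H.P)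
      + (complexify H.F - complexify H.P).conjTranspose * Z
      = (2 : ℝ) • (Z.conjTranspose * complexify H.R * Z)) :
    (((complexify H.F + complexify H.P).conjTranspose * Z + (complexify H.S + complexify H.N)) +
      ((complexify H.F + complexify H.P).conjTranspose * Z
        + (complexify H.S + complexify H.N)).conjTranspose).PosDef := by
  refine posDef_add_conjTranspose_of_posDef_fromBlocks ?_ ?_ hZ
  · have h := hK.map_ofReal
    rw [costMatrix, Matrix.fromBlocks_map] at h
    rw [← complexify_transpose]
    exact h
  · rw [← complexify_transpose, H.N_skew, complexify_neg]

theorem isESPR (hK : H.costMatrix.PosDef) : H.toLTISystem.IsESPR := by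
  have hre : ∀ ω : ℝ, (Complex.I * ω).re = 0 := fun ω => by simp
  refine ⟨⟨isRegularPair hK, fun s hs =>
    H.toLTISystem.not_isPole_transferFunction (det_pencil_ne_zero hK hs), fun ω _ => ?_⟩, ?_⟩
  · rw [transferAt_eq hK (hre ω).ge]
    exact posDef_of_power_balance hK (power_balance hK (hre ω))
  · have hY : ∃ Y, Filter.Tendsto (fun ω : ℝ =>
        ((Complex.I * ω) • H.effortMatrix - complexify (H.J - H.R))⁻¹) Filter.atTop (nhds Y) := by
      have hu : ∀ ω : ℝ, IsUnit ((Complex.I * ω) • H.effortMatrix - complexify (H.J - H.R)) :=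
        fun ω => isUnit_effort_pencil hK (hre ω).ge
      obtain ⟨q, r, e, W, T, J, -, -, hE, hA⟩ := exists_weierstrass_form hK
      simp only [hE, hA] at hu ⊢
      exact exists_tendsto_inv_of_weierstrass_form e J hu
    obtain ⟨Y, hY⟩ := hY
    have hZ : Filter.Tendsto (fun ω : ℝ =>
        ((Complex.I * ω) • H.effortMatrix - complexify (H.J - H.R))⁻¹
          * (complexify H.F - complexify H.P)) Filter.atTop
        (nhds (Y * (complexify H.F - complexify H.P))) :=
      ((continuous_id.matrix_mul continuous_const).tendsto Y).comp hY
    refine ⟨_, ?_, posDef_of_power_balance hK (Z := Y * (complexify H.F - complexify H.P)) ?_⟩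
    · simp_rw [fun ω : ℝ => transferAt_eq hK (hre ω).ge]
      have hc : Continuous fun Z : Matrix (Fin n) (Fin m) ℂ =>
          (complexify H.F + complexify H.P).conjTranspose * Z
            + (complexify H.S + complexify H.N) := by
        fun_prop
      exact (hc.tendsto _).comp hZ
    -- The balance has no `ω` in it apart from `Z`, so it passes to the limit. Strict positivity of
    -- `G + Gᴴ` alone would not.
    · have hcl : IsClosed {Z : Matrix (Fin n) (Fin m) ℂ |
          Z.conjTranspose * (complexify H.F - complexify H.P)
            + (complexify H.F - complexify H.P).conjTranspose * Z
            = (2 : ℝ) • (Z.conjTranspose * complexify H.R * Z)} :=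
        isClosed_eq (by fun_prop) (by fun_prop)
      exact hcl.mem_of_tendsto hZ (Filter.Eventually.of_forall fun ω => power_balance hK (hre ω))

end PHSystem

theorem mainTheorem5 {n m : ℕ} (H : PHSystem n m) (hK : H.costMatrix.PosDef) :
    H.toLTISystem.IsAdmissible ∧ H.toLTISystem.IsESPR :=
  ⟨PHSystem.isAdmissible hK, PHSystem.isESPR hK⟩
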